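/- Let $X$ be a real-valued random variable and let $n\ge 2$ be an integer such that $\mathsf{E}|X-\mathsf{E}X|^n<\infty$. Then $\mathsf{E}|X|^n<\infty$, so that the $n$-th cumulant $$\kappa_n(X)=\sum_{\pi\in\mathcal P(n)}(-1)^{|\pi|-1}(|\pi|-1)!\prod_{B\in\pi}\mathsf{E}\bigl[X^{|B|}\bigr]$$ is well defined, where $\mathcal P(n)$ is the set of all partitions of $\{1,\dots,n\}$ into nonempty blocks and $|\pi|$ is the number of blocks of $\pi$, and $$|\kappa_n(X)|\le C_{\mathrm{cen}}(n)\,\mathsf{E}|X-\mathsf{E}X|^n,\qquad C_{\mathrm{cen}}(n):=\sum_{\substack{\pi\in\mathcal P(n)\\ |B|\ge 2\ \forall B\in\pi}}(|\pi|-1)!.$$ Moreover, the equation $e^{\rho}=2+\rho$ has a unique positive solution $\rho_{\mathrm{cen}}$, it satisfies $|\rho_{\mathrm{cen}}-1.146|<0.0005$, and $$C_{\mathrm{cen}}(n)\sim\frac{(n-1)!}{\rho_{\mathrm{cen}}^{\,n}}\qquad(n\to\infty).$$ -/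

import Mathlib

open scoped Nat

/-- The `n`-th cumulant of a real random variable, defined by the moment-cumulant formula
`κ_n(X) = ∑_π (-1)^(|π|-1) (|π|-1)! ∏_{B ∈ π} E[X^|B|]`, where `π` runs over the partitions of an
`n`-element set into nonempty blocks (`n ≥ 1`, so that `|π| ≥ 1`). -/
noncomputable def cumulant {Ω : Type*} [MeasurableSpace Ω] (X : Ω → ℝ)
    (P : MeasureTheory.Measure Ω) (n : ℕ) : ℝ :=
  ∑ π : Finpartition (Finset.univ : Finset (Fin n)),
    (-1 : ℝ) ^ (π.parts.card - 1) * ((π.parts.card - 1)! : ℝ) *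
      ∏ B ∈ π.parts, ProbabilityTheory.moment X B.card P

/-- The sum of `(|π|-1)!` over the partitions `π` of an `n`-element set all of whose blocks have
at least two elements. -/
def centralCoeff (n : ℕ) : ℕ :=
  ∑ π : Finpartition (Finset.univ : Finset (Fin n)) with ∀ B ∈ π.parts, 2 ≤ B.card,
    (π.parts.card - 1)!

/-!
By Faà di Bruno's formula the cumulant `κ_n` is `n!` times the `n`-th coefficient of the logarithm
of the exponential generating function of the moments. Translating `X` by `c` multiplies that
generating function by `exp (c z)`, hence changes only `κ_1`. For centred `X` every partition with
a singleton block drops out, and Lyapunov's inequality bounds each remaining product of moments by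
`E|X|^n`.

The same formula applied to `2 + z - exp z`, whose derivatives at `0` are `1, 0, -1, -1, …`, shows
that `-centralCoeff (n + 1) / n!` is the `n`-th Taylor coefficient of its logarithmic derivative.
The only singularity of the latter in `|z| ≤ ρ` is a simple pole at `ρ`, because equality in the
triangle inequality for `∑_{k ≥ 2} z^k / k! = 1` forces `z = ρ`.
-/

section Finpartition

open Finset

variable {α : Type*} [DecidableEq α] {a : α} {s : Finset α}

theorem notMem_of_mem_insert_empty_parts (ha : a ∉ s) (π : Finpartition s) {B : Finset α}
    (hB : B ∈ insert ∅ π.parts) : a ∉ B := by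
  rcases mem_insert.1 hB with rfl | hB
  · exact notMem_empty a
  · exact fun haB => ha (π.subset hB haB)

/-- The partition of `insert a s` obtained from the partition `π` of `s` by adding `a` to the block
`B`; the choice `B = ∅` makes `{a}` a new block. -/
def finpartitionInsert (ha : a ∉ s) (π : Finpartition s) {B : Finset α}
    (hB : B ∈ insert ∅ π.parts) : Finpartition (insert a s) :=
  have hsub := fun C (hC : C ∈ π.parts) => π.subset hC
  .ofExistsUnique (insert (insert a B) (π.parts.erase B))
    (by grind)
    (by
      intro x hx
      rcases eq_or_ne x a with rfl | hxa
      · exact ⟨insert x B, by grind⟩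
      · obtain ⟨C, ⟨hC, hxC⟩, huniq⟩ := π.existsUnique_mem (mem_of_mem_insert_of_ne hx hxa)
        exact ⟨if C = B then insert a B else C, by grind⟩)
    (by simp [(insert_ne_empty a B).symm])

theorem parts_finpartitionInsert (ha : a ∉ s) (π : Finpartition s) {B : Finset α}
    (hB : B ∈ insert ∅ π.parts) :
    (finpartitionInsert ha π hB).parts = insert (insert a B) (π.parts.erase B) := rfl

theorem part_finpartitionInsert (ha : a ∉ s) (π : Finpartition s) {B : Finset α}
    (hB : B ∈ insert ∅ π.parts) : (finpartitionInsert ha π hB).part a = insert a B :=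
  Finpartition.part_eq_of_mem _ (mem_insert_self _ _) (mem_insert_self _ _)

theorem parts_eq_erase_insert_erase (π : Finpartition s) {B : Finset α}
    (hB : B ∈ insert ∅ π.parts) : π.parts = (insert B (π.parts.erase B)).erase ∅ := by
  grind [π.empty_notMem_parts]

theorem erase_part_finpartitionInsert (ha : a ∉ s) (π : Finpartition s) {B : Finset α}
    (hB : B ∈ insert ∅ π.parts) :
    (finpartitionInsert ha π hB).parts.erase (insert a B) = π.parts.erase B :=
  erase_insert fun h => ha (π.subset (mem_of_mem_erase h) (mem_insert_self a B))

theorem finpartitionInsert_inj (ha : a ∉ s) {π π' : Finpartition s} {B B' : Finset α}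
    {hB : B ∈ insert ∅ π.parts} {hB' : B' ∈ insert ∅ π'.parts}
    (h : finpartitionInsert ha π hB = finpartitionInsert ha π' hB') : π = π' ∧ B = B' := by
  obtain rfl : B = B' := by
    rw [← erase_insert (notMem_of_mem_insert_empty_parts ha π hB),
      ← part_finpartitionInsert ha π hB, h, part_finpartitionInsert,
      erase_insert (notMem_of_mem_insert_empty_parts ha π' hB')]
  refine ⟨Finpartition.ext ?_, rfl⟩
  rw [parts_eq_erase_insert_erase π hB, ← erase_part_finpartitionInsert ha π hB, h,
    erase_part_finpartitionInsert, ← parts_eq_erase_insert_erase π' hB']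

theorem parts_restrict_of_insert (ha : a ∉ s) (τ : Finpartition (insert a s)) :
    (τ.restrict (subset_insert a s)).parts =
      (insert ((τ.part a).erase a) (τ.parts.erase (τ.part a))).erase ∅ := by
  have hpart : τ.part a ∩ s = (τ.part a).erase a := by
    grind [τ.part_subset a]
  have hother : ∀ C ∈ τ.parts.erase (τ.part a), C ∩ s = C := by
    intro C hC
    obtain ⟨hne, hC⟩ := mem_erase.1 hC
    refine inter_eq_left.2 ((subset_insert_iff_of_notMem fun haC => ?_).1 (τ.subset hC))
    exact hne (τ.part_eq_of_mem hC haC).symm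
  change (τ.parts.image (· ∩ s)).erase ∅ = _
  rw [← insert_erase (τ.part_mem.2 (mem_insert_self a s)), image_insert, hpart,
    image_congr hother, image_id', erase_insert (notMem_erase _ _)]

theorem exists_finpartitionInsert_eq (ha : a ∉ s) (τ : Finpartition (insert a s)) :
    ∃ (π : Finpartition s) (B : Finset α) (hB : B ∈ insert ∅ π.parts),
      finpartitionInsert ha π hB = τ := by
  have hmem : τ.part a ∈ τ.parts := τ.part_mem.2 (mem_insert_self a s)
  have haτ : a ∈ τ.part a := τ.mem_part_self.2 (mem_insert_self a s)
  have hnotMem : (τ.part a).erase a ∉ τ.parts := by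
    intro h
    obtain ⟨x, hx⟩ := τ.nonempty_of_mem_parts h
    have := τ.eq_of_mem_parts h hmem hx (mem_of_mem_erase hx)
    exact notMem_erase a _ (this ▸ haτ)
  refine ⟨τ.restrict (subset_insert a s), (τ.part a).erase a, ?_, Finpartition.ext ?_⟩
  · grind [parts_restrict_of_insert ha τ]
  · rw [parts_finpartitionInsert, parts_restrict_of_insert ha, insert_erase haτ, erase_right_comm,
      erase_insert (mt mem_of_mem_erase hnotMem),
      erase_eq_of_notMem (mt mem_of_mem_erase τ.empty_notMem_parts), insert_erase hmem]

theorem sum_finpartition_insert {M : Type*} [AddCommMonoid M] (ha : a ∉ s)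
    (F : Finset (Finset α) → M) :
    ∑ τ : Finpartition (insert a s), F τ.parts =
      ∑ π : Finpartition s, (F (insert {a} π.parts) +
        ∑ B ∈ π.parts, F (insert (insert a B) (π.parts.erase B))) := by
  calc ∑ τ : Finpartition (insert a s), F τ.parts
      = ∑ π : Finpartition s, ∑ B ∈ insert ∅ π.parts,
          F (insert (insert a B) (π.parts.erase B)) := by
        rw [sum_sigma']
        symm
        refine sum_bij (fun p hp => finpartitionInsert ha p.1 (mem_sigma.1 hp).2)
          (fun _ _ => mem_univ _) ?_ ?_ (fun _ _ => rfl)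
        · rintro ⟨π, B⟩ hB ⟨π', B'⟩ hB' h
          obtain ⟨rfl, rfl⟩ := finpartitionInsert_inj ha h
          rfl
        · intro τ _
          obtain ⟨π, B, hB, rfl⟩ := exists_finpartitionInsert_eq ha τ
          exact ⟨⟨π, B⟩, by simpa using hB, rfl⟩
    _ = _ := by
        refine sum_congr rfl fun π _ => ?_
        rw [sum_insert π.empty_notMem_parts, erase_eq_of_notMem π.empty_notMem_parts,
          insert_empty_eq]

end Finpartition

section Derivation

open Finset

variable {A R : Type*} [CommSemiring A] [CommSemiring R] [Algebra A R] (D : Derivation A R R)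

theorem derivation_prod {ι : Type*} [DecidableEq ι] (s : Finset ι) (f : ι → R) :
    D (∏ i ∈ s, f i) = ∑ i ∈ s, (∏ j ∈ s.erase i, f j) * D (f i) := by
  induction s using Finset.induction_on with
  | empty => simp
  | insert a s ha ih =>
    rw [prod_insert ha, D.leibniz, ih, sum_insert ha, erase_insert ha, smul_eq_mul, smul_eq_mul,
      mul_sum, add_comm]
    congr 1
    refine sum_congr rfl fun i hi => ?_
    have hai : a ≠ i := fun h => ha (h ▸ hi)
    rw [erase_insert_of_ne hai, prod_insert (fun h => ha (mem_of_mem_erase h)), mul_assoc]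

theorem derivation_iterate_eq_sum_finpartition {u : R} {g : ℕ → R}
    (hg : ∀ k, D (g k) = g (k + 1) * D u) {α : Type*} [DecidableEq α] (s : Finset α) :
    D^[#s] (g 0) = ∑ π : Finpartition s, g #π.parts * ∏ B ∈ π.parts, D^[#B] u := by
  induction s using Finset.induction_on with
  | empty =>
    have : Unique (Finpartition (∅ : Finset α)) := inferInstanceAs (Unique (Finpartition ⊥))
    have hparts : ∀ π : Finpartition (∅ : Finset α), π.parts = ∅ := fun π => by simp
    simp [hparts]
  | insert a s ha ih =>
    rw [card_insert_of_notMem ha, Function.iterate_succ_apply', ih, map_sum,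
      sum_finpartition_insert ha fun parts => g #parts * ∏ B ∈ parts, D^[#B] u]
    refine sum_congr rfl fun π _ => ?_
    have hnew : ∀ C : Finset α, insert a C ∉ π.parts :=
      fun C hC => ha (π.subset hC (mem_insert_self a C))
    rw [D.leibniz, hg, derivation_prod, smul_eq_mul, smul_eq_mul, mul_sum, add_comm]
    congr 1
    · rw [← insert_empty_eq, card_insert_of_notMem (hnew ∅), prod_insert (hnew ∅), insert_empty_eq,
        card_singleton, Function.iterate_one]
      ring
    · refine sum_congr rfl fun B hB => ?_
      have hnew' : insert a B ∉ π.parts.erase B := mt mem_of_mem_erase (hnew B)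
      have haB : a ∉ B := fun h => ha (π.subset hB h)
      rw [card_insert_of_notMem hnew', prod_insert hnew', card_erase_add_one hB,
        card_insert_of_notMem haB, Function.iterate_succ_apply']
      ring

end Derivation

section PowerSeriesLog

open PowerSeries

section Algebra

variable {R : Type*} [CommRing R] [Algebra ℚ R]

theorem one_add_X_mul_derivative_log : (1 + X) * d⁄dX R (log R) = 1 := by
  ext (_ | n)
  · simp [add_mul, deriv_log]
  · simp [add_mul, deriv_log, coeff_succ_X_mul, coeff_one, pow_succ]

theorem derivative_rescale_exp (c : R) :
    d⁄dX R (rescale c (exp R)) = C c * rescale c (exp R) := by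
  ext n
  rw [coeff_derivative, coeff_C_mul, coeff_rescale, coeff_rescale, mul_assoc, ← coeff_derivative,
    derivative_exp, pow_succ']
  ring

theorem constantCoeff_rescale_exp (c : R) : constantCoeff (rescale c (exp R)) = 1 := by
  simp [← coeff_zero_eq_constantCoeff_apply]

end Algebra

variable {K : Type*} [Field K]

theorem derivative_C_mul_inv_pow_succ (f : K⟦X⟧) (k : ℕ) :
    d⁄dX K (C ((-1) ^ k * (k ! : K)) * f⁻¹ ^ (k + 1)) =
      C ((-1) ^ (k + 1) * ((k + 1)! : K)) * f⁻¹ ^ (k + 2) * d⁄dX K f := by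
  have hC : C ((-1) ^ (k + 1) * ((k + 1)! : K)) = -(k + 1) * C ((-1) ^ k * (k ! : K)) := by
    rw [show (-1) ^ (k + 1) * ((k + 1)! : K) = -(k + 1) * ((-1) ^ k * k !) by
      rw [Nat.factorial_succ]; push_cast; ring]
    simp
  simp only [Derivation.leibniz, derivative_C, smul_eq_mul, derivative_pow, derivative_inv', hC]
  push_cast
  ring

variable [CharZero K]

theorem derivative_logOf {f : K⟦X⟧} (hf : constantCoeff f = 1) :
    d⁄dX K (logOf f) = f⁻¹ * d⁄dX K f := by
  have hsubst : HasSubst (f - 1) := HasSubst.of_constantCoeff_zero' (by simp [hf])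
  have hinv : f * (d⁄dX K (log K)).subst (f - 1) = 1 := by
    have h := congrArg (subst (f - 1)) (one_add_X_mul_derivative_log (R := K))
    rw [subst_mul hsubst, subst_add hsubst, subst_X hsubst] at h
    simpa [← coe_substAlgHom hsubst] using h
  rw [logOf_eq, derivative_subst hsubst, map_sub, Derivation.map_one_eq_zero, sub_zero]
  congr 1
  rw [PowerSeries.eq_inv_iff_mul_eq_one (by simp [hf]), mul_comm, hinv]

theorem logOf_mul {f g : K⟦X⟧} (hf : constantCoeff f = 1) (hg : constantCoeff g = 1) :
    logOf (f * g) = logOf f + logOf g := by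
  have hfg : constantCoeff (f * g) = 1 := by simp [hf, hg]
  refine derivative.ext ?_ (by simp [constantCoeff_logOf, hf, hg, hfg])
  have hf0 : f * f⁻¹ = 1 := PowerSeries.mul_inv_cancel _ (by simp [hf])
  have hg0 : g * g⁻¹ = 1 := PowerSeries.mul_inv_cancel _ (by simp [hg])
  rw [map_add, derivative_logOf hfg, derivative_logOf hf, derivative_logOf hg,
    PowerSeries.mul_inv_rev, Derivation.leibniz, smul_eq_mul, smul_eq_mul]
  linear_combination g⁻¹ * d⁄dX K g * hf0 + f⁻¹ * d⁄dX K f * hg0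

theorem logOf_rescale_exp (c : K) : logOf (rescale c (exp K)) = C c * X := by
  have h1 := constantCoeff_rescale_exp c
  refine derivative.ext ?_ (by simp [constantCoeff_logOf h1])
  have hinv : (rescale c (exp K))⁻¹ * rescale c (exp K) = 1 :=
    PowerSeries.inv_mul_cancel _ (by simp [h1])
  rw [derivative_logOf h1, derivative_rescale_exp]
  simp only [Derivation.leibniz, derivative_X, derivative_C, smul_eq_mul, mul_zero, mul_one,
    add_zero]
  linear_combination C c * hinv

end PowerSeriesLog

section FormalCumulant

open Finset PowerSeries

theorem card_parts_ne_zero {n : ℕ} (hn : n ≠ 0) (π : Finpartition (univ : Finset (Fin n))) :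
    #π.parts ≠ 0 := by
  have : Nonempty (Fin n) := Fin.pos_iff_nonempty.1 (Nat.pos_of_ne_zero hn)
  simpa using (univ_nonempty (α := Fin n)).ne_empty

variable {R : Type*} [CommRing R]

/-- The `n`-th cumulant of the moment sequence `m`, given by the moment-cumulant formula (for
`n ≠ 0`). Not tying `m` to a random variable allows the same formula to count partitions. -/
def formalCumulant (m : ℕ → R) (n : ℕ) : R :=
  ∑ π : Finpartition (univ : Finset (Fin n)),
    (-1) ^ (#π.parts - 1) * ((#π.parts - 1)! : R) * ∏ B ∈ π.parts, m #B

theorem formalCumulant_congr {m m' : ℕ → R} {n : ℕ} (h : ∀ k ≤ n, m k = m' k) :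
    formalCumulant m n = formalCumulant m' n := by
  refine sum_congr rfl fun π _ => ?_
  rw [prod_congr rfl fun B _ => h #B (by simpa using B.card_le_univ)]

theorem formalCumulant_of_apply_one_eq_zero {m : ℕ → R} (hm : m 1 = 0) (n : ℕ) :
    formalCumulant m n = ∑ π : Finpartition (univ : Finset (Fin n)) with ∀ B ∈ π.parts, 2 ≤ #B,
      (-1) ^ (#π.parts - 1) * ((#π.parts - 1)! : R) * ∏ B ∈ π.parts, m #B := by
  refine (sum_filter_of_ne fun π _ hπ B hB => ?_).symm
  by_contra! hB2
  have hB1 : #B = 1 := by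
    have := (π.nonempty_of_mem_parts hB).card_pos
    omega
  exact hπ (mul_eq_zero_of_right _ (prod_eq_zero hB (by rw [hB1, hm])))

theorem formalCumulant_eq_neg_centralCoeff {m : ℕ → R} (hm1 : m 1 = 0)
    (hm : ∀ k, 2 ≤ k → m k = -1) {n : ℕ} (hn : n ≠ 0) :
    formalCumulant m n = -centralCoeff n := by
  rw [formalCumulant_of_apply_one_eq_zero hm1, centralCoeff, Nat.cast_sum, ← sum_neg_distrib]
  refine sum_congr rfl fun π hπ => ?_
  rw [prod_congr rfl fun B hB => hm #B ((mem_filter.1 hπ).2 B hB), prod_const, mul_right_comm,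
    ← pow_add, Odd.neg_one_pow (by have := card_parts_ne_zero hn π; grind), neg_one_mul]

theorem abs_formalCumulant_le_centralCoeff_mul_pow {m : ℕ → ℝ} (hm1 : m 1 = 0) {r : ℝ} {n : ℕ}
    (hm : ∀ k ≤ n, 2 ≤ k → |m k| ≤ r ^ k) :
    |formalCumulant m n| ≤ centralCoeff n * r ^ n := by
  rw [formalCumulant_of_apply_one_eq_zero hm1, centralCoeff, Nat.cast_sum, sum_mul]
  refine (abs_sum_le_sum_abs _ _).trans (sum_le_sum fun π hπ => ?_)
  have hprod : ∏ B ∈ π.parts, |m #B| ≤ r ^ n := by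
    calc ∏ B ∈ π.parts, |m #B| ≤ ∏ B ∈ π.parts, r ^ #B :=
          prod_le_prod (fun _ _ => abs_nonneg _) fun B hB =>
            hm #B (by simpa using B.card_le_univ) ((mem_filter.1 hπ).2 B hB)
      _ = r ^ n := by
          rw [prod_pow_eq_pow_sum, π.sum_card_parts, Finset.card_univ, Fintype.card_fin]
  rw [abs_mul, abs_mul, abs_prod, abs_neg_one_pow, one_mul, Nat.abs_cast]
  gcongr

variable {K : Type*} [Field K] [CharZero K]

theorem formalCumulant_eq_coeff_logOf {f : K⟦X⟧} (hf : constantCoeff f = 1) {n : ℕ} (hn : n ≠ 0) :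
    formalCumulant (fun k => k ! * coeff k f) n = n ! * coeff n (logOf f) := by
  let g : ℕ → K⟦X⟧
    | 0 => logOf f
    | k + 1 => C ((-1) ^ k * (k ! : K)) * f⁻¹ ^ (k + 1)
  have hg : ∀ k, d⁄dX K (g k) = g (k + 1) * d⁄dX K f
    | 0 => by simp [g, derivative_logOf hf]
    | k + 1 => derivative_C_mul_inv_pow_succ f k
  have hg0 : ∀ k ≠ 0, constantCoeff (g k) = (-1) ^ (k - 1) * ((k - 1)! : K)
    | k + 1, _ => by simp [g, hf]
  have hfaa := congrArg (constantCoeff (R := K))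
    (derivation_iterate_eq_sum_finpartition (d⁄dX K) hg (univ : Finset (Fin n)))
  rw [Finset.card_univ, Fintype.card_fin, constantCoeff_iterate_derivative, map_sum] at hfaa
  refine Eq.trans (sum_congr rfl fun π _ => ?_) hfaa.symm
  simp only [map_mul, map_prod, constantCoeff_iterate_derivative,
    hg0 _ (card_parts_ne_zero hn π)]

theorem formalCumulant_binomialTransform {m : ℕ → K} (hm : m 0 = 1) (c : K) {n : ℕ} (hn : 2 ≤ n) :
    formalCumulant (fun k => ∑ j ∈ range (k + 1), m j * c ^ (k - j) * k.choose j) n =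
      formalCumulant m n := by
  have hfac : ∀ k : ℕ, (k ! : K) ≠ 0 := fun k => by exact_mod_cast k.factorial_ne_zero
  set M : K⟦X⟧ := PowerSeries.mk fun k => m k / k ! with hM
  have hM1 : constantCoeff M = 1 := by simp [hM, ← coeff_zero_eq_constantCoeff_apply, hm]
  have hE1 := constantCoeff_rescale_exp c
  have hmM : ∀ k, m k = k ! * coeff k M := fun k => by
    rw [hM, coeff_mk, mul_div_cancel₀ _ (hfac k)]
  have hbinom : ∀ k, ∑ j ∈ range (k + 1), m j * c ^ (k - j) * k.choose j =
      k ! * coeff k (M * rescale c (exp K)) := fun k => by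
    rw [coeff_mul, Finset.Nat.sum_antidiagonal_eq_sum_range_succ_mk, mul_sum]
    refine sum_congr rfl fun j hj => ?_
    rw [hM, coeff_mk, coeff_rescale, coeff_exp, one_div, map_inv₀, map_natCast,
      Nat.cast_choose K (Nat.lt_succ_iff.1 (Finset.mem_range.1 hj))]
    field_simp [hfac]
  rw [formalCumulant_congr fun k _ => hbinom k, formalCumulant_congr fun k _ => hmM k,
    formalCumulant_eq_coeff_logOf (by simp [hM1, hE1]) (by omega),
    formalCumulant_eq_coeff_logOf hM1 (by omega), logOf_mul hM1 hE1, logOf_rescale_exp,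
    map_add, coeff_C_mul, coeff_X, if_neg (by omega), mul_zero, add_zero]

end FormalCumulant

section Cumulant

open Finset MeasureTheory ProbabilityTheory

variable {Ω : Type*} [MeasurableSpace Ω] {P : Measure Ω} {X : Ω → ℝ} {n k : ℕ}

theorem cumulant_eq_formalCumulant (X : Ω → ℝ) (P : Measure Ω) (n : ℕ) :
    cumulant X P n = formalCumulant (moment X · P) n := rfl

theorem memLp_of_integrable_abs_pow (hn : n ≠ 0) (hX : AEMeasurable X P)
    (h : Integrable (fun ω => |X ω| ^ n) P) : MemLp X n P := by
  rw [← integrable_norm_rpow_iff hX.aestronglyMeasurable (by simpa using hn) (by simp)]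
  simpa using h

theorem lpNorm_natCast_pow (hn : n ≠ 0) (hX : AEStronglyMeasurable X P) :
    lpNorm X n P ^ n = ∫ ω, |X ω| ^ n ∂P := by
  have h0 : 0 ≤ ∫ ω, |X ω| ^ n ∂P := integral_nonneg fun ω => by positivity
  rw [lpNorm_eq_integral_norm_rpow_toReal (by simpa using hn) (by simp) hX]
  simpa using Real.rpow_inv_natCast_pow h0 hn

theorem memLp_of_memLp_sub_const [IsFiniteMeasure P] {E : Type*} [NormedAddCommGroup E]
    {f : Ω → E} {c : E} {p : ENNReal} (h : MemLp (fun ω => f ω - c) p P) : MemLp f p P := by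
  simpa [Pi.add_def] using h.add (memLp_const c)

theorem integrable_pow_of_memLp [IsFiniteMeasure P] (hX : MemLp X n P) (hk : k ≤ n) :
    Integrable (fun ω => X ω ^ k) P := by
  have hXk : MemLp X k P := hX.mono_exponent (by exact_mod_cast hk)
  refine (integrable_norm_iff (hXk.1.pow k)).1 ?_
  simpa using hXk.integrable_norm_pow'

theorem moment_add_const [IsFiniteMeasure P] (hX : MemLp X n P) (hk : k ≤ n) (c : ℝ) :
    moment (fun ω => X ω + c) k P =
      ∑ j ∈ range (k + 1), moment X j P * c ^ (k - j) * k.choose j := by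
  simp only [moment_def, Pi.pow_apply, add_pow]
  rw [integral_finsetSum]
  · simp only [integral_mul_const]
  · intro j hj
    exact ((integrable_pow_of_memLp hX (by grind)).mul_const _).mul_const _

variable [IsProbabilityMeasure P]

theorem lpNorm_mono_exponent {E : Type*} [NormedAddCommGroup E] {f : Ω → E} {p q : ENNReal}
    (hf : MemLp f q P) (hpq : p ≤ q) : lpNorm f p P ≤ lpNorm f q P := by
  rw [← toReal_eLpNorm hf.1, ← toReal_eLpNorm hf.1]
  exact ENNReal.toReal_mono hf.2.ne (eLpNorm_le_eLpNorm_of_exponent_le hpq hf.1)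

theorem abs_moment_le_lpNorm_pow (hX : MemLp X n P) (hk : k ≤ n) (hk0 : k ≠ 0) :
    |moment X k P| ≤ lpNorm X n P ^ k :=
  calc |moment X k P| ≤ ∫ ω, |X ω| ^ k ∂P := by
        simpa [moment_def] using abs_integral_le_integral_abs (f := X ^ k) (μ := P)
    _ = lpNorm X k P ^ k := (lpNorm_natCast_pow hk0 hX.1).symm
    _ ≤ lpNorm X n P ^ k :=
        pow_le_pow_left₀ lpNorm_nonneg (lpNorm_mono_exponent hX (by exact_mod_cast hk)) k

theorem cumulant_add_const (hn : 2 ≤ n) (hX : MemLp X n P) (c : ℝ) :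
    cumulant (fun ω => X ω + c) P n = cumulant X P n := by
  rw [cumulant_eq_formalCumulant, cumulant_eq_formalCumulant,
    formalCumulant_congr fun k hk => moment_add_const hX hk c,
    formalCumulant_binomialTransform (by simp [moment_def]) c hn]

theorem abs_cumulant_le_of_integral_eq_zero (hn : n ≠ 0) (hX : MemLp X n P)
    (hX0 : ∫ ω, X ω ∂P = 0) :
    |cumulant X P n| ≤ centralCoeff n * ∫ ω, |X ω| ^ n ∂P := by
  rw [cumulant_eq_formalCumulant, ← lpNorm_natCast_pow hn hX.1]
  exact abs_formalCumulant_le_centralCoeff_mul_pow (by rw [moment_one, hX0])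
    fun k hk hk2 => abs_moment_le_lpNorm_pow hX hk (by omega)

theorem abs_cumulant_le (hn : 2 ≤ n) (hX : MemLp X n P) :
    |cumulant X P n| ≤ centralCoeff n * ∫ ω, |X ω - ∫ ω', X ω' ∂P| ^ n ∂P := by
  have hcentred : ∫ ω, (X ω - ∫ ω', X ω' ∂P) ∂P = 0 := by
    rw [integral_sub (hX.integrable (by exact_mod_cast (by omega : 1 ≤ n))) (integrable_const _)]
    simp
  rw [← cumulant_add_const hn hX (-∫ ω', X ω' ∂P)]
  exact abs_cumulant_le_of_integral_eq_zero (by omega) (hX.sub (memLp_const _)) hcentred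

end Cumulant

section TaylorSeries

open Finset PowerSeries Filter
open scoped Topology ContDiff

variable {𝕜 : Type*} [NontriviallyNormedField 𝕜]

/-- The Taylor series of `f` at the origin, as a formal power series. -/
noncomputable def taylorSeries (f : 𝕜 → 𝕜) : 𝕜⟦X⟧ :=
  PowerSeries.mk fun n => iteratedDeriv n f 0 / n !

theorem coeff_taylorSeries (f : 𝕜 → 𝕜) (n : ℕ) :
    coeff n (taylorSeries f) = iteratedDeriv n f 0 / n ! :=
  coeff_mk _ _

theorem constantCoeff_taylorSeries (f : 𝕜 → 𝕜) : constantCoeff (taylorSeries f) = f 0 := by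
  simp [← coeff_zero_eq_constantCoeff_apply, coeff_taylorSeries]

theorem taylorSeries_congr {f g : 𝕜 → 𝕜} (h : f =ᶠ[𝓝 0] g) : taylorSeries f = taylorSeries g := by
  ext n
  rw [coeff_taylorSeries, coeff_taylorSeries, h.iteratedDeriv_eq n]

variable [CharZero 𝕜]

theorem factorial_mul_coeff_taylorSeries (f : 𝕜 → 𝕜) (n : ℕ) :
    n ! * coeff n (taylorSeries f) = iteratedDeriv n f 0 := by
  rw [coeff_taylorSeries, mul_div_cancel₀ _ (by exact_mod_cast n.factorial_ne_zero)]

theorem taylorSeries_mul {f g : 𝕜 → 𝕜} (hf : ContDiffAt 𝕜 ∞ f 0) (hg : ContDiffAt 𝕜 ∞ g 0) :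
    taylorSeries (f * g) = taylorSeries f * taylorSeries g := by
  ext n
  have hfac : ∀ k : ℕ, (k ! : 𝕜) ≠ 0 := fun k => by exact_mod_cast k.factorial_ne_zero
  rw [coeff_taylorSeries, coeff_mul, Finset.Nat.sum_antidiagonal_eq_sum_range_succ_mk,
    iteratedDeriv_mul (hf.of_le (by exact_mod_cast le_top)) (hg.of_le (by exact_mod_cast le_top)),
    sum_div]
  refine sum_congr rfl fun k hk => ?_
  rw [coeff_taylorSeries, coeff_taylorSeries,
    Nat.cast_choose 𝕜 (Nat.lt_succ_iff.1 (Finset.mem_range.1 hk))]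
  field_simp [hfac]

theorem derivative_taylorSeries (f : 𝕜 → 𝕜) :
    d⁄dX 𝕜 (taylorSeries f) = taylorSeries (deriv f) := by
  ext n
  have hn : (n + 1 : 𝕜) ≠ 0 := n.cast_add_one_ne_zero
  rw [coeff_derivative, coeff_taylorSeries, coeff_taylorSeries, iteratedDeriv_succ',
    Nat.factorial_succ]
  push_cast
  field_simp

theorem taylorSeries_sub_const (a : 𝕜) : taylorSeries (fun z => z - a) = X - C a := by
  refine derivative.ext ?_ (by simp [constantCoeff_taylorSeries])
  rw [derivative_taylorSeries]
  ext (_ | n) <;> simp [coeff_taylorSeries, iteratedDeriv_const, coeff_one]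

theorem hasSum_coeff_taylorSeries_mul_pow {f : ℂ → ℂ} {r : ℝ}
    (hf : DifferentiableOn ℂ f (Metric.ball 0 r)) {z : ℂ} (hz : z ∈ Metric.ball 0 r) :
    HasSum (fun k => coeff k (taylorSeries f) * z ^ k) (f z) := by
  have hterm : ∀ k : ℕ, coeff k (taylorSeries f) * z ^ k =
      (k ! : ℂ)⁻¹ • (z - 0) ^ k • iteratedDeriv k f 0 := fun k => by
    rw [coeff_taylorSeries, sub_zero, smul_eq_mul, smul_eq_mul]
    ring
  simpa only [hterm] using Complex.hasSum_taylorSeries_on_ball hf hz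

end TaylorSeries

section SimplePole

open Finset PowerSeries Filter
open scoped Topology

theorem sum_coeff_X_sub_C_mul_mul_pow {R : Type*} [CommRing R] (a : R) (A : R⟦X⟧) (n : ℕ) :
    ∑ k ∈ range (n + 1), coeff k ((X - C a) * A) * a ^ k = -(coeff n A * a ^ (n + 1)) := by
  induction n with
  | zero => simp [mul_comm]
  | succ n ih =>
    rw [sum_range_succ, ih, sub_mul, map_sub, coeff_succ_X_mul, coeff_C_mul]
    ring

theorem tendsto_coeff_mul_pow_of_hasSum {R : Type*} [CommRing R] [TopologicalSpace R]
    [IsTopologicalRing R] {a g : R} {A : R⟦X⟧}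
    (h : HasSum (fun k => coeff k ((X - C a) * A) * a ^ k) g) :
    Tendsto (fun n => coeff n A * a ^ (n + 1)) atTop (𝓝 (-g)) := by
  have hlim := ((tendsto_add_atTop_iff_nat 1).2 h.tendsto_sum_nat).neg
  simpa only [sum_coeff_X_sub_C_mul_mul_pow, neg_neg] using hlim

theorem exists_ball_forall_ne_zero {E F : Type*} [NormedAddCommGroup E] [NormedSpace ℝ E]
    [ProperSpace E] [TopologicalSpace F] [T1Space F] [Zero F] {f : E → F} (hf : Continuous f)
    {r : ℝ} (hr : 0 ≤ r) (h : ∀ x, ‖x‖ ≤ r → f x ≠ 0) :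
    ∃ R > r, ∀ x ∈ Metric.ball (0 : E) R, f x ≠ 0 := by
  obtain ⟨ε, hε, hsub⟩ := (isCompact_closedBall (0 : E) r).exists_thickening_subset_open
    (isOpen_compl_singleton.preimage hf : IsOpen (f ⁻¹' {0}ᶜ)) fun x hx => h x (by simpa using hx)
  rw [thickening_closedBall hε hr] at hsub
  exact ⟨ε + r, by linarith, fun x hx => hsub hx⟩

theorem dslope_ne_zero_of_forall_eq {𝕜 : Type*} [NontriviallyNormedField 𝕜] {u : 𝕜 → 𝕜} {a z : 𝕜}
    (hroot : u a = 0) (hsimple : deriv u a ≠ 0) (hz : u z = 0 → z = a) :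
    dslope u a z ≠ 0 := by
  intro h0
  obtain rfl | hza := eq_or_ne z a
  · exact hsimple (by rw [← dslope_same, h0])
  · have hfactor := sub_smul_dslope u a z
    rw [h0, smul_zero, hroot, sub_zero] at hfactor
    exact hza (hz hfactor.symm)

theorem differentiable_dslope {u : ℂ → ℂ} (hu : Differentiable ℂ u) (a : ℂ) :
    Differentiable ℂ (dslope u a) := by
  rw [← differentiableOn_univ] at hu ⊢
  exact (Complex.differentiableOn_dslope univ_mem).2 hu

theorem taylorSeries_eq_X_sub_C_mul_of_root {u : ℂ → ℂ} (hu : Differentiable ℂ u) {a : ℂ}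
    (hroot : u a = 0) : taylorSeries u = (X - C a) * taylorSeries (dslope u a) := by
  rw [← taylorSeries_sub_const,
    ← taylorSeries_mul (by fun_prop) (differentiable_dslope hu a).contDiff.contDiffAt]
  congr 1 with z
  simpa [hroot] using (sub_smul_dslope u a z).symm

theorem tendsto_coeff_logDeriv_mul_pow {u : ℂ → ℂ} (hu : Differentiable ℂ u) {ρ : ℂ} (hρ : ρ ≠ 0)
    (hroot : u ρ = 0) (hsimple : deriv u ρ ≠ 0) (hdom : ∀ z, ‖z‖ ≤ ‖ρ‖ → u z = 0 → z = ρ) :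
    Tendsto (fun n => coeff n ((taylorSeries u)⁻¹ * d⁄dX ℂ (taylorSeries u)) * ρ ^ (n + 1)) atTop
      (𝓝 (-1)) := by
  set δ : ℂ → ℂ := dslope u ρ
  set G : ℂ → ℂ := deriv u / δ
  have hδ : Differentiable ℂ δ := differentiable_dslope hu ρ
  obtain ⟨R, hR, hne⟩ := exists_ball_forall_ne_zero hδ.continuous (norm_nonneg ρ) fun z hz =>
    dslope_ne_zero_of_forall_eq hroot hsimple (hdom z hz)
  have hball : Metric.ball (0 : ℂ) R ∈ 𝓝 0 := Metric.ball_mem_nhds _ ((norm_nonneg ρ).trans_lt hR)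
  have hGd : DifferentiableOn ℂ G (Metric.ball 0 R) :=
    hu.deriv.differentiableOn.div hδ.differentiableOn hne
  have hGρ : G ρ = 1 := by
    simp only [G, δ, Pi.div_apply, dslope_same, div_self hsimple]
  have hU : taylorSeries u = (X - C ρ) * taylorSeries δ :=
    taylorSeries_eq_X_sub_C_mul_of_root hu hroot
  have hU' : d⁄dX ℂ (taylorSeries u) = taylorSeries G * taylorSeries δ := by
    rw [derivative_taylorSeries,
      ← taylorSeries_mul (hGd.analyticAt hball).contDiffAt hδ.contDiff.contDiffAt]
    refine taylorSeries_congr ?_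
    filter_upwards [hball] with z hz
    exact (div_mul_cancel₀ _ (hne z hz)).symm
  have hU0 : constantCoeff (taylorSeries u) ≠ 0 := by
    rw [constantCoeff_taylorSeries]
    exact fun h => hρ (hdom 0 (by simp) h).symm
  have hpole : (X - C ρ) * ((taylorSeries u)⁻¹ * d⁄dX ℂ (taylorSeries u)) = taylorSeries G := by
    rw [hU', mul_left_comm, mul_left_comm _ (taylorSeries G), ← hU, mul_left_comm,
      PowerSeries.inv_mul_cancel _ hU0, mul_one]
  rw [← hGρ]
  refine tendsto_coeff_mul_pow_of_hasSum ?_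
  rw [hpole]
  exact hasSum_coeff_taylorSeries_mul_pow hGd (by simpa using hR)

end SimplePole

section DominantRoot

open Finset

theorem eq_of_norm_le_of_hasSum {ι : Type*} {w : ι → ℂ} {r : ι → ℝ} {s : ℝ}
    (hwr : ∀ i, ‖w i‖ ≤ r i) (hr : HasSum r s) (hw : HasSum w s) (i : ι) : w i = r i := by
  have hre : ∀ j, (w j).re ≤ r j := fun j => (Complex.re_le_norm _).trans (hwr j)
  have hdiff : HasSum (fun j => r j - (w j).re) 0 := by
    simpa using hr.sub (Complex.hasSum_re hw)
  have hzero := (hasSum_zero_iff_of_nonneg fun j => sub_nonneg.2 (hre j)).1 hdiff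
  have hri : r i = (w i).re := sub_eq_zero.1 (congrFun hzero i)
  have hnorm : (w i).re = ‖w i‖ := le_antisymm (Complex.re_le_norm _) (hri ▸ hwr i)
  rw [hri, hnorm]
  exact Complex.eq_coe_norm_of_nonneg (Complex.re_eq_norm.1 hnorm)

theorem hasSum_pow_div_factorial_add_two {𝕜 : Type*} [RCLike 𝕜] (z : 𝕜) :
    HasSum (fun k : ℕ => z ^ (k + 2) / (k + 2)!) (NormedSpace.exp z - 1 - z) := by
  have h := (hasSum_nat_add_iff' 2).2 (NormedSpace.expSeries_div_hasSum_exp z)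
  simpa [sum_range_succ, sub_sub] using h

theorem eq_of_cexp_eq_two_add {ρ : ℝ} (hexp : Real.exp ρ = 2 + ρ) {z : ℂ} (hz : ‖z‖ ≤ ρ)
    (hzexp : Complex.exp z = 2 + z) : z = ρ := by
  have hρsum : HasSum (fun k : ℕ => ρ ^ (k + 2) / (k + 2)!) 1 := by
    have h := hasSum_pow_div_factorial_add_two ρ
    rwa [← Real.exp_eq_exp_ℝ, hexp, show 2 + ρ - 1 - ρ = 1 by ring] at h
  have hzsum : HasSum (fun k : ℕ => z ^ (k + 2) / (k + 2)!) ((1 : ℝ) : ℂ) := by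
    have h := hasSum_pow_div_factorial_add_two z
    rwa [← Complex.exp_eq_exp_ℂ, hzexp, show 2 + z - 1 - z = (1 : ℝ) by push_cast; ring] at h
  have hle : ∀ k : ℕ, ‖z ^ (k + 2) / (k + 2)!‖ ≤ ρ ^ (k + 2) / (k + 2)! := fun k => by
    rw [norm_div, norm_pow, RCLike.norm_natCast]
    gcongr
  have hpow : ∀ k : ℕ, z ^ (k + 2) = ρ ^ (k + 2) := fun k => by
    have h := eq_of_norm_le_of_hasSum hle hρsum hzsum k
    push_cast at h
    exact (div_left_inj' (by exact_mod_cast (k + 2).factorial_ne_zero)).1 h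
  have hρ : (ρ : ℂ) ≠ 0 := by
    intro h
    rw [Complex.ofReal_eq_zero.1 h] at hexp
    norm_num at hexp
  exact mul_left_cancel₀ (pow_ne_zero 2 hρ) (by linear_combination hpow 1 - z * hpow 0)

end DominantRoot

section Asymptotics

open Finset PowerSeries Filter
open scoped Topology

theorem deriv_two_add_sub_cexp :
    deriv (fun z : ℂ => 2 + z - Complex.exp z) = fun z => 1 - Complex.exp z := by
  funext z
  exact (((hasDerivAt_id z).const_add 2).sub (Complex.hasDerivAt_exp z)).deriv

theorem iteratedDeriv_add_two_two_add_sub_cexp (k : ℕ) :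
    iteratedDeriv (k + 2) (fun z : ℂ => 2 + z - Complex.exp z) 0 = -1 := by
  have hderiv : deriv (fun z : ℂ => 1 - Complex.exp z) = fun z => -Complex.exp z := by
    funext z
    exact ((Complex.hasDerivAt_exp z).const_sub 1).deriv
  rw [iteratedDeriv_succ', iteratedDeriv_succ', deriv_two_add_sub_cexp, hderiv,
    iteratedDeriv_fun_neg, iteratedDeriv_eq_iterate, Complex.iter_deriv_exp, Complex.exp_zero]

theorem coeff_logDeriv_taylorSeries_two_add_sub_cexp (n : ℕ) :
    coeff n ((taylorSeries fun z => 2 + z - Complex.exp z)⁻¹ *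
      d⁄dX ℂ (taylorSeries fun z => 2 + z - Complex.exp z)) = -(centralCoeff (n + 1) / n !) := by
  set u : ℂ → ℂ := fun z => 2 + z - Complex.exp z with hu
  have hu0 : constantCoeff (taylorSeries u) = 1 := by
    rw [constantCoeff_taylorSeries]
    norm_num [hu]
  have hlog : -(centralCoeff (n + 1) : ℂ) = (n + 1)! * coeff (n + 1) (logOf (taylorSeries u)) := by
    rw [← formalCumulant_eq_coeff_logOf hu0 n.succ_ne_zero]
    simp only [factorial_mul_coeff_taylorSeries]
    refine (formalCumulant_eq_neg_centralCoeff ?_ (fun k hk => ?_) n.succ_ne_zero).symm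
    · simp [hu, iteratedDeriv_one, deriv_two_add_sub_cexp]
    · obtain ⟨j, rfl⟩ := Nat.exists_eq_add_of_le' hk
      exact iteratedDeriv_add_two_two_add_sub_cexp j
  have hn : (n ! : ℂ) ≠ 0 := by exact_mod_cast n.factorial_ne_zero
  rw [← derivative_logOf hu0, coeff_derivative, ← neg_div, hlog, Nat.factorial_succ]
  push_cast
  field_simp

variable {ρ : ℝ}

theorem tendsto_centralCoeff_succ_div_factorial_mul_pow (hρ : 0 < ρ)
    (hexp : Real.exp ρ = 2 + ρ) :
    Tendsto (fun n : ℕ => (centralCoeff (n + 1) : ℝ) / n ! * ρ ^ (n + 1)) atTop (𝓝 1) := by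
  have hcexp : Complex.exp ρ = 2 + ρ := by exact_mod_cast congrArg Complex.ofReal hexp
  have hsimple : deriv (fun z : ℂ => 2 + z - Complex.exp z) ρ ≠ 0 := by
    simp only [deriv_two_add_sub_cexp, hcexp]
    norm_cast
    linarith
  have hlim := tendsto_coeff_logDeriv_mul_pow (u := fun z => 2 + z - Complex.exp z)
    (by fun_prop) (by exact_mod_cast hρ.ne') (by simp [hcexp]) hsimple fun z hz hz0 =>
      eq_of_cexp_eq_two_add hexp (by simpa [abs_of_pos hρ] using hz) (sub_eq_zero.1 hz0).symm
  rw [← tendsto_ofReal_iff]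
  simpa [coeff_logDeriv_taylorSeries_two_add_sub_cexp] using hlim.neg

theorem isEquivalent_centralCoeff (hρ : 0 < ρ) (hexp : Real.exp ρ = 2 + ρ) :
    Asymptotics.IsEquivalent atTop (fun n : ℕ => (centralCoeff n : ℝ))
      (fun n : ℕ => ((n - 1)! : ℝ) / ρ ^ n) := by
  rw [Asymptotics.isEquivalent_iff_tendsto_one (Eventually.of_forall fun n => by positivity),
    ← tendsto_add_atTop_iff_nat 1]
  refine (tendsto_centralCoeff_succ_div_factorial_mul_pow hρ hexp).congr fun n => ?_
  simp only [Pi.div_apply, Nat.add_sub_cancel]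
  field_simp

end Asymptotics

section Root

open Real

theorem strictMonoOn_exp_sub_id : StrictMonoOn (fun x => exp x - x) (Set.Ici 0) := by
  intro x hx y _ hxy
  have hsplit : exp y = exp x * exp (y - x) := by rw [← exp_add, add_sub_cancel]
  have hgap : y - x + 1 < exp (y - x) := add_one_lt_exp (by linarith)
  have hone : 1 ≤ exp x := one_le_exp hx
  change exp x - x < exp y - y
  nlinarith

theorem exp_1p1455_lt_two_add : exp 1.1455 < 2 + 1.1455 := by
  have hfrac : exp 0.1455 < 1.15665 := by
    refine (exp_bound' (n := 4) (by norm_num) (by norm_num) (by norm_num)).trans_lt ?_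
    norm_num [Finset.sum_range_succ, Nat.factorial]
  calc exp 1.1455 = exp 1 * exp 0.1455 := by rw [← exp_add]; norm_num
    _ < 2.7182818286 * 1.15665 := by gcongr; exact exp_one_lt_d9
    _ < 2 + 1.1455 := by norm_num

theorem two_add_lt_exp_1p1465 : 2 + 1.1465 < exp 1.1465 := by
  have hfrac : 1.15775 < exp 0.1465 := by
    refine lt_of_lt_of_le ?_ (sum_le_exp_of_nonneg (by norm_num) 4)
    norm_num [Finset.sum_range_succ, Nat.factorial]
  calc (2 + 1.1465 : ℝ) < 2.7182818283 * 1.15775 := by norm_num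
    _ < exp 1 * exp 0.1465 := by gcongr; exact exp_one_gt_d9
    _ = exp 1.1465 := by rw [← exp_add]; norm_num

theorem exists_exp_eq_two_add : ∃ ρ ∈ Set.Ioo (1.1455 : ℝ) 1.1465, exp ρ = 2 + ρ := by
  obtain ⟨ρ, hρ, h⟩ := intermediate_value_Ioo (f := fun x => exp x - (2 + x)) (by norm_num)
    (by fun_prop) ⟨sub_neg.2 exp_1p1455_lt_two_add, sub_pos.2 two_add_lt_exp_1p1465⟩
  exact ⟨ρ, hρ, sub_eq_zero.1 h⟩

end Root

theorem theorem3p2 :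
    (∀ (Ω : Type*) [MeasurableSpace Ω] (P : MeasureTheory.Measure Ω)
        [MeasureTheory.IsProbabilityMeasure P] (X : Ω → ℝ) (n : ℕ),
        2 ≤ n → AEMeasurable X P →
        MeasureTheory.Integrable (fun ω => |X ω - ∫ ω', X ω' ∂P| ^ n) P →
        MeasureTheory.Integrable (fun ω => |X ω| ^ n) P ∧
        |cumulant X P n| ≤ (centralCoeff n : ℝ) * ∫ ω, |X ω - ∫ ω', X ω' ∂P| ^ n ∂P) ∧
    ∃ ρ : ℝ, 0 < ρ ∧ Real.exp ρ = 2 + ρ ∧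
      (∀ x : ℝ, 0 < x → Real.exp x = 2 + x → x = ρ) ∧
      |ρ - 1.146| < 0.0005 ∧
      Asymptotics.IsEquivalent Filter.atTop (fun n : ℕ => (centralCoeff n : ℝ))
        (fun n : ℕ => ((n - 1)! : ℝ) / ρ ^ n) := by
  refine ⟨fun Ω _ P _ X n hn hX hXn => ?_, ?_⟩
  · have hXLp : MeasureTheory.MemLp X n P := memLp_of_memLp_sub_const
      (memLp_of_integrable_abs_pow (by omega) (hX.sub_const _) hXn)
    exact ⟨integrable_pow_of_memLp hXLp.abs le_rfl, abs_cumulant_le hn hXLp⟩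
  · obtain ⟨ρ, ⟨hlo, hhi⟩, hexp⟩ := exists_exp_eq_two_add
    have hρ : 0 < ρ := by linarith
    refine ⟨ρ, hρ, hexp, fun x hx hxexp => ?_, ?_, isEquivalent_centralCoeff hρ hexp⟩
    · exact strictMonoOn_exp_sub_id.injOn hx.le hρ.le (by linarith)
    · exact abs_lt.2 ⟨by linarith, by linarith⟩
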